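/- Conventions. An algebra $\mathbf A=\langle A,(f_i)_{i\in S}\rangle$ is a set with finitary operations. An \emph{expanded group} is an algebra having $+,-,0$ among its fundamental operations such that $\langle A,+,-,0\rangle$ is a group; it is an \emph{expanded elementary abelian group} if this group is abelian and all its nonzero elements have the same prime order. $\mathrm{Pol}_n(\mathbf A)$ is the set of $n$-ary polynomial functions of $\mathbf A$ (the functions induced by terms built from variables, constants from $A$ and fundamental operations), and $\mathrm{Pol}_{n,s}(\mathbf A)$ is the set of maps $A^n\to A^s$, $\mathbf a\mapsto(f_1(\mathbf a),\dots,f_s(\mathbf a))$ with $f_1,\dots,f_s\in\mathrm{Pol}_n(\mathbf A)$. For congruences $\theta_1,\dots,\theta_k,\beta$ of $\mathbf A$, the higher commutator $[\theta_1,\dots,\theta_k,\beta]$ is the smallest congruence $\delta$ such that for every polynomial function $f$ and all vectors $\mathbf a_i,\mathbf b_i$ $(1\le i\le k)$ and $\mathbf c,\mathbf d$ over $A$ with $\mathbf a_i\equiv_{\theta_i}\mathbf b_i$ and $\mathbf c\equiv_\beta\mathbf d$ componentwise: if $f(\mathbf x_1,\dots,\mathbf x_k,\mathbf c)\equiv_\delta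 f(\mathbf x_1,\dots,\mathbf x_k,\mathbf d)$ for each of the $2^k-1$ choices of $\mathbf x_i$ as $\mathbf a_i$ or $\mathbf b_i$ other than choosing $\mathbf b_i$ for every $i$, then $f(\mathbf b_1,\dots,\mathbf b_k,\mathbf c)\equiv_\delta f(\mathbf b_1,\dots,\mathbf b_k,\mathbf d)$. The algebra $\mathbf A$ is \emph{$k$-supernilpotent} if $[1_A,\dots,1_A]=0_A$, with $k+1$ entries $1_A$, where $1_A$ and $0_A$ are the largest and the smallest congruence of $\mathbf A$. For $\mathbf y\in A^n$, $\operatorname{wt}(\mathbf y)$ is the number of $j\in\{1,\dots,n\}$ with $\mathbf y(j)\ne 0$. Theorem. Let $n,s,t,k_1,\dots,k_t$ be positive integers. For each $i\in\{1,\dots,t\}$ let $\mathbf B_i$ be a $k_i$-supernilpotent expanded elementary abelian group with $|\mathbf B_i|=p_i^{\alpha_i}$, where $p_i$ is a prime (the $p_i$ need not be distinct) and $\alpha_i$ is a positive integer, all $\mathbf B_i$ having the same signature with the same symbols for $+,-,0$. Let $\mathbf A:=\prod_{i=1}^t\mathbf B_i$ be the direct product, let $F\in\mathrm{Pol}_{n,s}(\mathbf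 A)$, and let $\mathbf a\in A^n$. Then there is $\mathbf y\in A^n$ with $$\operatorname{wt}(\mathbf y)\le\sum_{i=1}^t k_i\,s\,\alpha_i\,(p_i-1)$$ such that $F(\mathbf a)=F(\mathbf y)$. -/

import Mathlib

universe u v w

namespace UniversalAlgebra

/-! Algebras are structures for a first-order language without relation symbols; the fundamental
operations are the interpretations of the function symbols. -/

section General

variable (L : FirstOrder.Language.{u, v}) (A : Type w) [L.Structure A]

/-- The polynomial functions on `A` in variables indexed by `ι`: the functions induced by terms
built from the variables, constants from `A` and the fundamental operations.
`Pol L A (Fin n)` is the set of `n`-ary polynomial functions. -/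
def Pol (ι : Type*) : Set ((ι → A) → A) :=
  {f | ∃ t : L.Term (A ⊕ ι), ∀ x : ι → A, f x = t.realize (Sum.elim id x)}

/-- The polynomial maps from `A ^ n` to `A ^ s`. -/
def PolMap (n s : ℕ) : Set ((Fin n → A) → (Fin s → A)) :=
  {F | ∀ r : Fin s, (fun x => F x r) ∈ Pol L A (Fin n)}

variable {A}

/-- A congruence: an equivalence relation preserved by all fundamental operations. -/
def IsCongruence (δ : Setoid A) : Prop :=
  ∀ (m : ℕ) (f : L.Functions m) (x y : Fin m → A), (∀ j, δ (x j) (y j)) →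
    δ (FirstOrder.Language.Structure.funMap f x) (FirstOrder.Language.Structure.funMap f y)

/-- Given vectors `a i`, `b i` (of lengths `m i`) for `i < k` and a set `S` of indices, the tuple of
vectors whose `i`-th member is `b i` if `i ∈ S` and `a i` otherwise. -/
def mix {k : ℕ} {m : Fin k → ℕ} (S : Finset (Fin k)) (a b : (i : Fin k) → Fin (m i) → A) :
    (Σ i : Fin k, Fin (m i)) → A :=
  fun j => if j.1 ∈ S then b j.1 j.2 else a j.1 j.2

/-- The `k`-dimensional term condition `C(α 0, …, α (k-1), β; δ)`: whenever `f` is a polynomial,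
`a i ≡ b i` modulo `α i` and `c ≡ d` modulo `β`, and `f (x, c) ≡ f (x, d)` modulo `δ` for each of
the `2 ^ k - 1` choices `x` of vectors from the pairs `a i, b i` other than choosing every `b i`,
then also `f (b, c) ≡ f (b, d)` modulo `δ`. -/
def Centralizes {k : ℕ} (α : Fin k → Setoid A) (β δ : Setoid A) : Prop :=
  ∀ (m : Fin k → ℕ) (l : ℕ),
    ∀ f ∈ Pol L A ((Σ i : Fin k, Fin (m i)) ⊕ Fin l),
    ∀ (a b : (i : Fin k) → Fin (m i) → A) (c d : Fin l → A),
      (∀ i j, α i (a i j) (b i j)) →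
      (∀ j, β (c j) (d j)) →
      (∀ S : Finset (Fin k), S ≠ Finset.univ →
        δ (f (Sum.elim (mix S a b) c)) (f (Sum.elim (mix S a b) d))) →
      δ (f (Sum.elim (mix Finset.univ a b) c)) (f (Sum.elim (mix Finset.univ a b) d))

/-- The `(k+1)`-ary higher commutator `[α 0, …, α (k-1), β]`: the smallest congruence `δ` with
`C(α 0, …, α (k-1), β; δ)`. -/
def higherCommutator {k : ℕ} (α : Fin k → Setoid A) (β : Setoid A) : Setoid A :=
  sInf {δ | IsCongruence L δ ∧ Centralizes L α β δ}

variable (A)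

/-- `A` is `k`-supernilpotent: `[1, …, 1] = 0` with `k + 1` entries `1`, where `1` and `0` are the
largest and the smallest congruence of `A`. -/
def IsSupernilpotent (k : ℕ) : Prop :=
  higherCommutator L (fun _ : Fin k => (⊤ : Setoid A)) ⊤ = ⊥

end General

/-- The direct product of a family of algebras, with componentwise operations (and relations). -/
instance piStructure (L : FirstOrder.Language.{u, v}) {ι : Type*} (B : ι → Type*) [∀ i, L.Structure (B i)] :
    L.Structure (∀ i, B i) where
  funMap f x := fun i => FirstOrder.Language.Structure.funMap f (fun j => x j i)
  RelMap r x := ∀ i, FirstOrder.Language.Structure.RelMap r (fun j => x j i)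

/-- A choice of symbols `+`, `-`, `0` in the language `L`. -/
class GroupSymbols (L : FirstOrder.Language.{u, v}) where
  /-- the binary symbol `+` -/
  add : L.Functions 2
  /-- the unary symbol `-` -/
  neg : L.Functions 1
  /-- the nullary symbol `0` -/
  zero : L.Functions 0

/-- The algebra `B` is an expanded group, with the group `(B, +, -, 0)` as its group reduct. -/
structure IsExpandedGroup (L : FirstOrder.Language.{u, v}) [GroupSymbols L] (B : Type w) [AddGroup B]
    [L.Structure B] : Prop where
  funMap_add : ∀ x : Fin 2 → B,
    FirstOrder.Language.Structure.funMap (GroupSymbols.add : L.Functions 2) x = x 0 + x 1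
  funMap_neg : ∀ x : Fin 1 → B,
    FirstOrder.Language.Structure.funMap (GroupSymbols.neg : L.Functions 1) x = -x 0
  funMap_zero : ∀ x : Fin 0 → B,
    FirstOrder.Language.Structure.funMap (GroupSymbols.zero : L.Functions 0) x = 0

/-- The algebra `B` is an expanded elementary abelian group: its group reduct is abelian and all
nonzero elements have the same prime order. -/
structure IsExpandedElementaryAbelianGroup (L : FirstOrder.Language.{u, v}) [GroupSymbols L] (B : Type w)
    [AddGroup B] [L.Structure B] : Prop extends IsExpandedGroup L B where
  add_comm : ∀ x y : B, x + y = y + x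
  addOrderOf_eq : ∃ q : ℕ, q.Prime ∧ ∀ x : B, x ≠ 0 → addOrderOf x = q

/-- The weight of a vector: the number of its nonzero entries. -/
noncomputable def weight {A : Type*} [Zero A] {n : ℕ} (a : Fin n → A) : ℕ :=
  Set.ncard {j : Fin n | a j ≠ 0}

end UniversalAlgebra

namespace UniversalAlgebra

open Finset FirstOrder

/-! ### Functions of bounded degree on the Boolean cube -/

section Cube

variable {V : Type*} [DecidableEq V] {R : Type*} [CommRing R]

/-! Fix one factor and let `S` range over the sets of coordinates of `a` that are kept, the others
becoming `0`. Supernilpotence makes each polynomial function, read in `ZMod p`-coordinates, a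
polynomial of degree at most `k` in the 0-1 indicators of `S` (`IsSupernilpotent.altSum_eq_zero`,
`mem_cubeDegreeLE`). So `F` becomes `s * α` such polynomials.

A Chevalley–Warning type argument (`exists_card_le_forall_eq`) takes a minimal `U` with the same
values as the full set. A product of Fermat indicators, of degree at most `k * s * α * (p - 1)`, is
nonzero at `U` and zero at its proper subsets, so its coefficient at `U` is nonzero and `U.card` is
at most that degree.

In the product each factor uses its own `U i`; the support of the resulting vector lies in their
union, so the bounds add up. -/

/-- The alternating sum of `g` over the subsets of `T`. -/
def altSum {M : Type*} [AddCommGroup M] (T : Finset V) (g : Finset V → M) : M :=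
  ∑ S ∈ T.powerset, (-1 : ℤ) ^ (T \ S).card • g S

lemma altSum_map {M N : Type*} [AddCommGroup M] [AddCommGroup N] (h : M →+ N) (T : Finset V)
    (g : Finset V → M) : altSum T (fun S => h (g S)) = h (altSum T g) := by
  simp [altSum, map_sum, map_zsmul]

/-- The alternating sum over the subsets of `T` vanishes if `g` does not depend on some element
of `T`. -/
lemma altSum_eq_zero {M : Type*} [AddCommGroup M] {T : Finset V} {g : Finset V → M} {v : V}
    (hv : v ∈ T) (hg : ∀ S, v ∉ S → g (insert v S) = g S) : altSum T g = 0 := by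
  obtain ⟨T, hvT, rfl⟩ : ∃ T', v ∉ T' ∧ insert v T' = T :=
    ⟨T.erase v, notMem_erase _ _, insert_erase hv⟩
  rw [altSum, sum_powerset_insert hvT, ← sum_add_distrib]
  -- The terms of `S` and `insert v S` carry opposite signs and cancel.
  refine sum_eq_zero fun S hS => ?_
  have hS' := mem_powerset.1 hS
  have hvS : v ∉ S := fun h => hvT (hS' h)
  have h1 : insert v T \ insert v S = T \ S := by
    rw [insert_sdiff_insert, sdiff_insert_of_notMem hvT]
  rw [hg S hvS, h1, insert_sdiff_of_notMem _ hvS,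
    card_insert_of_notMem (fun h => hvT (mem_sdiff.1 h).1), pow_succ]
  simp

/-- Möbius inversion on the Boolean cube. -/
lemma sum_altSum {M : Type*} [AddCommGroup M] (g : Finset V → M) (S : Finset V) :
    ∑ T ∈ S.powerset, altSum T g = g S := by
  induction S using Finset.induction_on generalizing g with
  | empty => simp [altSum]
  | insert v S hv ih =>
    have key : ∀ T ∈ S.powerset, altSum (insert v T) g
        = altSum T (fun R => g (insert v R)) - altSum T g := by
      intro T hT
      have hvT : v ∉ T := fun h => hv (mem_powerset.1 hT h)
      rw [altSum, sum_powerset_insert hvT, altSum, altSum, sub_eq_neg_add, ← sum_neg_distrib]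
      congr 1 <;> refine sum_congr rfl fun R hR => ?_
      · have hvR : v ∉ R := fun h => hvT (mem_powerset.1 hR h)
        rw [insert_sdiff_of_notMem _ hvR, card_insert_of_notMem (fun h => hvT (mem_sdiff.1 h).1),
          pow_succ]
        simp
      · rw [insert_sdiff_insert, sdiff_insert_of_notMem hvT]
    rw [sum_powerset_insert hv, sum_congr rfl key, sum_sub_distrib, ih, ih]
    abel

/-- The monomial `∏ v ∈ T, x v` as a function on the Boolean cube. -/
def cubeMonomial (R : Type*) [CommRing R] (T : Finset V) : Finset V → R :=
  fun S => if T ⊆ S then 1 else 0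

/-- The functions on the Boolean cube given by polynomials of degree at most `d`. -/
def cubeDegreeLE (V : Type*) [DecidableEq V] (R : Type*) [CommRing R] (d : ℕ) :
    Submodule R (Finset V → R) :=
  Submodule.span R (cubeMonomial R '' {T | T.card ≤ d})

/-- The variables are idempotent on the cube, so a product of monomials merges their supports. -/
lemma cubeMonomial_mul (T T' : Finset V) :
    cubeMonomial R T * cubeMonomial R T' = cubeMonomial R (T ∪ T') := by
  ext S
  simp only [Pi.mul_apply, cubeMonomial, union_subset_iff]
  split_ifs <;> simp_all

lemma mul_mem_cubeDegreeLE {d e : ℕ} {f g : Finset V → R} (hf : f ∈ cubeDegreeLE V R d)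
    (hg : g ∈ cubeDegreeLE V R e) : f * g ∈ cubeDegreeLE V R (d + e) := by
  have h := Submodule.mul_mem_mul hf hg
  rw [cubeDegreeLE, cubeDegreeLE, Submodule.span_mul_span] at h
  refine Submodule.span_mono ?_ h
  rintro _ ⟨_, ⟨T, hT, rfl⟩, _, ⟨T', hT', rfl⟩, rfl⟩
  exact ⟨T ∪ T', (card_union_le _ _).trans (add_le_add hT hT'), (cubeMonomial_mul T T').symm⟩

lemma one_mem_cubeDegreeLE (d : ℕ) : (1 : Finset V → R) ∈ cubeDegreeLE V R d :=
  Submodule.subset_span ⟨∅, by simp, by ext; simp [cubeMonomial]⟩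

lemma pow_mem_cubeDegreeLE {d : ℕ} {f : Finset V → R} (hf : f ∈ cubeDegreeLE V R d) (m : ℕ) :
    f ^ m ∈ cubeDegreeLE V R (m * d) := by
  induction m with
  | zero => simpa using one_mem_cubeDegreeLE _
  | succ m ih => rw [pow_succ, Nat.succ_mul]; exact mul_mem_cubeDegreeLE ih hf

lemma prod_mem_cubeDegreeLE {σ : Type*} (s : Finset σ) {d : ℕ} {f : σ → Finset V → R}
    (hf : ∀ r, f r ∈ cubeDegreeLE V R d) : ∏ r ∈ s, f r ∈ cubeDegreeLE V R (s.card * d) := by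
  classical
  induction s using Finset.induction_on with
  | empty => simpa using one_mem_cubeDegreeLE _
  | insert r s hr ih =>
    rw [prod_insert hr, card_insert_of_notMem hr, Nat.succ_mul, add_comm]
    exact mul_mem_cubeDegreeLE (hf r) ih

/-- By linearity a monomial suffices, and one of degree at most `d` ignores some element of the
larger set `T`. -/
lemma altSum_eq_zero_of_mem {d : ℕ} {f : Finset V → R} (hf : f ∈ cubeDegreeLE V R d)
    {T : Finset V} (hT : d < T.card) : altSum T f = 0 := by
  induction hf using Submodule.span_induction with
  | mem f hf =>
    obtain ⟨U, hU, rfl⟩ := hf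
    obtain ⟨v, hvT, hvU⟩ := exists_mem_notMem_of_card_lt_card (lt_of_le_of_lt hU hT)
    refine altSum_eq_zero hvT fun S _ => ?_
    simp only [cubeMonomial, subset_insert_iff_of_notMem hvU]
  | zero => simp [altSum]
  | add f g _ _ hf hg =>
    simp only [altSum, Pi.add_apply, smul_add, sum_add_distrib] at hf hg ⊢
    rw [hf, hg, add_zero]
  | smul c f _ hf =>
    have := altSum_map (AddMonoidHom.mulLeft c) T f
    rw [hf, map_zero] at this
    exact this

/-- By Möbius inversion the alternating sums are the coefficients of `f` in the monomials. -/
lemma mem_cubeDegreeLE [Fintype V] {d : ℕ} {f : Finset V → R}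
    (hf : ∀ T : Finset V, d < T.card → altSum T f = 0) : f ∈ cubeDegreeLE V R d := by
  have h : f = ∑ T : Finset V, altSum T f • cubeMonomial R T := by
    ext S
    rw [← sum_altSum f S, Finset.sum_apply]
    simp only [Pi.smul_apply, cubeMonomial, smul_eq_mul, mul_ite, mul_one, mul_zero]
    rw [← sum_filter]
    exact sum_congr (by ext; simp) fun _ _ => rfl
  rw [h]
  refine Submodule.sum_mem _ fun T _ => ?_
  by_cases hT : d < T.card
  · rw [hf T hT, zero_smul]; exact Submodule.zero_mem _
  · exact Submodule.smul_mem _ _ (Submodule.subset_span ⟨T, not_lt.1 hT, rfl⟩)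

/-- The values at the all-ones point of finitely many polynomials of degree at most `d` over
`ZMod p` are attained together at a point of the Boolean cube of small weight. -/
lemma exists_card_le_forall_eq [Fintype V] {p : ℕ} (hp : p.Prime) {σ : Type*} [Fintype σ] {d : ℕ}
    (f : σ → Finset V → ZMod p) (hf : ∀ r, f r ∈ cubeDegreeLE V (ZMod p) d) :
    ∃ U : Finset V, U.card ≤ Fintype.card σ * ((p - 1) * d) ∧ ∀ r, f r U = f r univ := by
  have : Fact p.Prime := ⟨hp⟩
  obtain ⟨U, hU, hmin⟩ := exists_min_image
    (univ.filter fun U : Finset V => ∀ r, f r U = f r univ) card ⟨univ, by simp⟩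
  simp only [mem_filter, mem_univ, true_and] at hU hmin
  refine ⟨U, ?_, hU⟩
  by_contra! hcard
  -- By Fermat, `g` is the indicator of the sets at which every `f r` takes its value at `univ`.
  set g : Finset V → ZMod p :=
    ∏ r, (1 - (f r - f r univ • (1 : Finset V → ZMod p)) ^ (p - 1)) with hg
  have hgmem : g ∈ cubeDegreeLE V (ZMod p) (Fintype.card σ * ((p - 1) * d)) :=
    prod_mem_cubeDegreeLE univ fun r => Submodule.sub_mem _ (one_mem_cubeDegreeLE _)
      (pow_mem_cubeDegreeLE (Submodule.sub_mem _ (hf r)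
        (Submodule.smul_mem _ _ (one_mem_cubeDegreeLE _))) _)
  have hp1 : p - 1 ≠ 0 := Nat.sub_ne_zero_of_lt hp.one_lt
  have hzero := altSum_eq_zero_of_mem hgmem hcard
  -- Minimality of `U` kills all terms but `g U = 1`, contradicting `hzero`.
  rw [altSum, sum_eq_single_of_mem U (mem_powerset_self U)] at hzero
  · simp [hg, hU, hp1] at hzero
  · intro S hS hSU
    have hlt : S.card < U.card :=
      card_lt_card ((mem_powerset.1 hS).ssubset_of_ne hSU)
    obtain ⟨r, hr⟩ : ∃ r, f r S ≠ f r univ := by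
      by_contra! h
      exact absurd (hmin S h) (not_le.2 hlt)
    have : g S = 0 := by
      rw [hg, prod_apply]
      refine prod_eq_zero (mem_univ r) ?_
      simp [ZMod.pow_card_sub_one_eq_one (sub_ne_zero.2 hr)]
    rw [this, smul_zero]

end Cube

/-! ### Polynomial functions -/

section Polynomials

variable {L : FirstOrder.Language.{u, v}} {B : Type w} [L.Structure B]

lemma comp_mem_Pol {ι κ : Type*} {f : (ι → B) → B} (hf : f ∈ Pol L B ι) {q : ι → (κ → B) → B}
    (hq : ∀ i, q i ∈ Pol L B κ) : (fun x => f fun i => q i x) ∈ Pol L B κ := by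
  obtain ⟨t, ht⟩ := hf
  choose r hr using hq
  refine ⟨t.subst (Sum.elim (fun b => Language.var (Sum.inl b)) r), fun x => ?_⟩
  rw [Language.Term.realize_subst]
  refine (ht _).trans ?_
  congr 1
  ext (b | i)
  · rfl
  · exact hr i x

lemma const_mem_Pol {κ : Type*} (b : B) : (fun _ => b) ∈ Pol L B κ :=
  ⟨Language.var (Sum.inl b), fun _ => rfl⟩

lemma eval_mem_Pol {κ : Type*} (j : κ) : (fun x => x j) ∈ Pol L B κ :=
  ⟨Language.var (Sum.inr j), fun _ => rfl⟩

/-- The polynomial functions on an expanded group form a group. -/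
def polAddSubgroup [GroupSymbols L] [AddGroup B] (hB : IsExpandedGroup L B) (κ : Type*) :
    AddSubgroup ((κ → B) → B) where
  carrier := Pol L B κ
  zero_mem' := const_mem_Pol 0
  add_mem' := by
    rintro f g ⟨t, ht⟩ ⟨r, hr⟩
    refine ⟨Language.Term.func GroupSymbols.add ![t, r], fun x => ?_⟩
    simp [hB.funMap_add, ht, hr]
  neg_mem' := by
    rintro f ⟨t, ht⟩
    refine ⟨Language.Term.func GroupSymbols.neg ![t], fun x => ?_⟩
    simp [hB.funMap_neg, ht]

/-- The term condition passes to infima, so the commutator satisfies it itself. -/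
lemma IsSupernilpotent.centralizes {k : ℕ} (h : IsSupernilpotent L B k) :
    Centralizes L (fun _ : Fin k => (⊤ : Setoid B)) ⊤ ⊥ := by
  rw [← h]
  intro m l f hf a b c d hab hcd hS δ hδ
  exact hδ.2 m l f hf a b c d hab hcd fun S hSu => hS S hSu δ hδ

/-- The restriction of a vector to a set of coordinates, extended by zero. -/
def restrictZero {V M : Type*} [DecidableEq V] [Zero M] (S : Finset V) (a : V → M) : V → M :=
  fun j => if j ∈ S then a j else 0

/-- In a `k`-supernilpotent expanded abelian group, polynomial functions have degree at most `k`
along every Boolean cube through zero. -/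
lemma IsSupernilpotent.altSum_eq_zero [GroupSymbols L] {B : Type w} [AddCommGroup B]
    [L.Structure B] (hB : IsExpandedGroup L B) {k : ℕ} (h : IsSupernilpotent L B k) {n : ℕ}
    {f : (Fin n → B) → B} (hf : f ∈ Pol L B (Fin n)) (a : Fin n → B) {T : Finset (Fin n)}
    (hT : k < T.card) : altSum T (fun S => f (restrictZero S a)) = 0 := by
  classical
  obtain ⟨T₀, hT₀, hcard⟩ := exists_subset_card_eq hT.le
  obtain ⟨v, hvT, hvT₀⟩ := exists_mem_notMem_of_card_lt_card (hcard.trans_lt hT)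
  let e : Fin k ≃ T₀ := (T₀.equivFinOfCardEq hcard).symm
  -- The `k` coordinates in `T₀` become the first `k` blocks, each of length one; all others, among
  -- them `v ∈ T \ T₀`, go to the last block.
  let w : Fin n → (Σ _ : Fin k, Fin 1) ⊕ Fin n := fun j =>
    if hj : j ∈ T₀ then Sum.inl ⟨e.symm ⟨j, hj⟩, 0⟩ else Sum.inr j
  have hwe : ∀ i, w (e i) = Sum.inl ⟨i, 0⟩ := fun i => by simp [w]
  have hwv : w v = Sum.inr v := by simp [w, hvT₀]
  let g : ((Σ _ : Fin k, Fin 1) ⊕ Fin n → B) → B := fun z =>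
    altSum T fun S => f (restrictZero S (z ∘ w))
  have hg : g ∈ Pol L B ((Σ _ : Fin k, Fin 1) ⊕ Fin n) := by
    have : g = ∑ S ∈ T.powerset, (-1 : ℤ) ^ (T \ S).card •
        fun z : (Σ _ : Fin k, Fin 1) ⊕ Fin n → B => f (restrictZero S (z ∘ w)) := by
      ext z; simp [g, altSum, Finset.sum_apply]
    rw [this]
    refine (polAddSubgroup hB ((Σ _ : Fin k, Fin 1) ⊕ Fin n)).sum_mem fun S _ =>
      (polAddSubgroup hB _).zsmul_mem ?_ _
    refine comp_mem_Pol (q := fun j z => restrictZero S (z ∘ w) j) hf fun j => ?_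
    by_cases hj : j ∈ S
    · simpa [restrictZero, hj] using eval_mem_Pol (w j)
    · simpa [restrictZero, hj] using const_mem_Pol (0 : B)
  have habs : ∀ z, (∃ j ∈ T, z (w j) = 0) → g z = 0 := by
    rintro z ⟨j, hj, hz⟩
    refine UniversalAlgebra.altSum_eq_zero hj fun S hjS => ?_
    congr 1
    ext i
    by_cases hij : i = j
    · subst hij; simp [restrictZero, hjS, hz]
    · simp [restrictZero, hij]
  -- Each mix but the full one has a zero at a coordinate in `T₀`, so there both sides vanish by
  -- `habs`. At the full mix, `c = 0` puts a zero at `v`, and `d = a` gives the alternating sum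
  -- sought.
  have key := h.centralizes (fun _ => 1) n g hg (fun _ _ => 0) (fun i _ => a (e i)) 0 a
    (fun _ _ => trivial) (fun _ => trivial) ?_
  · have h0 : g (Sum.elim (mix univ (fun _ _ => 0) fun i _ => a (e i)) 0) = 0 :=
      habs _ ⟨v, hvT, by simp [hwv]⟩
    have h1 : (Sum.elim (mix univ (fun _ _ => 0) fun i _ => a (e i)) a) ∘ w = a := by
      ext j
      by_cases hj : j ∈ T₀ <;> simp [w, hj, mix]
    have key' : g _ = g _ := key
    rw [h0] at key'
    simp only [g, h1] at key'
    exact key'.symm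
  · intro S hS
    obtain ⟨i, hi⟩ : ∃ i, i ∉ S := by
      by_contra! hall
      exact hS (eq_univ_iff_forall.2 hall)
    have h2 : ∀ c, g (Sum.elim (mix S (fun _ _ => 0) fun i _ => a (e i)) c) = 0 := fun c =>
      habs _ ⟨e i, hT₀ (e i).2, by rw [hwe]; simp [mix, hi]⟩
    rw [h2, h2]

/-- A group of exponent `p` and order `p ^ α` has `α` additive coordinates in `ZMod p`. -/
lemma exists_coordinates {B : Type*} [AddCommGroup B] {p α : ℕ} (hp : p.Prime)
    (hpB : ∀ x : B, p • x = 0) (hcard : Nat.card B = p ^ α) :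
    ∃ c : Fin α → B →+ ZMod p, ∀ x y, (∀ j, c j x = c j y) → x = y := by
  have : Fact p.Prime := ⟨hp⟩
  have : Finite B := Nat.finite_of_card_ne_zero (hcard ▸ pow_ne_zero _ hp.ne_zero)
  suffices h : ∀ [Module (ZMod p) B],
      ∃ c : Fin α → B →+ ZMod p, ∀ x y, (∀ j, c j x = c j y) → x = y from
    @h (AddCommGroup.zmodModule hpB)
  intro _
  have hrank : Module.finrank (ZMod p) B = α := by
    have h : Nat.card B = Nat.card (ZMod p) ^ Module.finrank (ZMod p) B :=
      Module.natCard_eq_pow_finrank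
    rw [hcard, Nat.card_zmod] at h
    exact (Nat.pow_right_injective hp.two_le h).symm
  let b : Module.Basis (Fin α) (ZMod p) B := Module.finBasisOfFinrankEq (ZMod p) B hrank
  exact ⟨fun j => (b.coord j).toAddMonoidHom, fun x y h => b.ext_elem h⟩

lemma IsSupernilpotent.exists_restrictZero_eq [GroupSymbols L] {B : Type w} [AddCommGroup B]
    [L.Structure B] (hB : IsExpandedGroup L B) {k : ℕ} (h : IsSupernilpotent L B k) {p α : ℕ}
    (hp : p.Prime) (hpB : ∀ x : B, p • x = 0) (hcard : Nat.card B = p ^ α) {n s : ℕ}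
    {F : (Fin n → B) → Fin s → B} (hF : F ∈ PolMap L B n s) (a : Fin n → B) :
    ∃ U : Finset (Fin n), U.card ≤ k * s * α * (p - 1) ∧ F a = F (restrictZero U a) := by
  obtain ⟨c, hc⟩ := exists_coordinates hp hpB hcard
  obtain ⟨U, hU, hUeq⟩ := exists_card_le_forall_eq hp (d := k)
    (fun (r : Fin s × Fin α) (S : Finset (Fin n)) => c r.2 (F (restrictZero S a) r.1))
    fun r => mem_cubeDegreeLE fun T hT => by
      have := altSum_map (c r.2) T fun S => F (restrictZero S a) r.1
      rw [h.altSum_eq_zero hB (hF r.1) a hT, map_zero] at this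
      exact this
  refine ⟨U, hU.trans_eq ?_, ?_⟩
  · simp only [Fintype.card_prod, Fintype.card_fin]; ring
  · have huniv : restrictZero univ a = a := by ext; simp [restrictZero]
    ext r
    refine hc _ _ fun j => ?_
    have := hUeq (r, j)
    simp only [huniv] at this
    exact this.symm

/-- Polynomial functions of a product act componentwise by polynomial functions. -/
lemma exists_mem_Pol_of_mem_Pol_pi {τ : Type*} {B : τ → Type*} [∀ i, L.Structure (B i)] {ι : Type*}
    {f : (ι → ∀ i, B i) → ∀ i, B i} (hf : f ∈ Pol L (∀ i, B i) ι) (i : τ) :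
    ∃ g ∈ Pol L (B i) ι, ∀ x, f x i = g fun j => x j i := by
  obtain ⟨t, ht⟩ := hf
  refine ⟨_, ⟨t.relabel (Sum.map (fun b => b i) id), fun _ => rfl⟩, fun x => ?_⟩
  rw [ht, Language.Term.realize_relabel]
  clear ht
  induction t with
  | var z => cases z <;> rfl
  | func F ts ih =>
    simp only [Language.Term.realize_func]
    exact congrArg (Language.Structure.funMap F) (funext ih)

/-- The common prime order of the nonzero elements divides `p ^ α`, hence is `p`. -/
lemma IsExpandedElementaryAbelianGroup.prime_nsmul_eq_zero [GroupSymbols L] {B : Type w} [AddGroup B]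
    [L.Structure B] (hB : IsExpandedElementaryAbelianGroup L B) {p α : ℕ} (hp : p.Prime)
    (hcard : Nat.card B = p ^ α) (x : B) : p • x = 0 := by
  obtain ⟨q, hq, hord⟩ := hB.addOrderOf_eq
  by_cases hx : x = 0
  · simp [hx]
  · have hdvd : addOrderOf x ∣ p ^ α := hcard ▸ addOrderOf_dvd_natCard x
    rw [hord x hx] at hdvd
    rw [← (Nat.prime_dvd_prime_iff_eq hq hp).1 (hq.dvd_of_dvd_pow hdvd), ← hord x hx]
    exact addOrderOf_nsmul_eq_zero x

end Polynomials

end UniversalAlgebra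

theorem mainTheorem4 (L : FirstOrder.Language.{u, v}) [L.IsAlgebraic]
    [UniversalAlgebra.GroupSymbols L]
    (n s t : ℕ) (hn : 1 ≤ n) (hs : 1 ≤ s) (ht : 1 ≤ t)
    (k p α : Fin t → ℕ) (hk : ∀ i, 1 ≤ k i) (hp : ∀ i, (p i).Prime) (hα : ∀ i, 1 ≤ α i)
    (B : Fin t → Type w) [∀ i, AddGroup (B i)] [∀ i, L.Structure (B i)]
    (hB : ∀ i, UniversalAlgebra.IsExpandedElementaryAbelianGroup L (B i))
    (hsn : ∀ i, UniversalAlgebra.IsSupernilpotent L (B i) (k i))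
    (hcard : ∀ i, Nat.card (B i) = p i ^ α i)
    (F : (Fin n → ∀ i, B i) → (Fin s → ∀ i, B i))
    (hF : F ∈ UniversalAlgebra.PolMap L (∀ i, B i) n s)
    (a : Fin n → ∀ i, B i) :
    ∃ y : Fin n → ∀ i, B i,
      UniversalAlgebra.weight y ≤ ∑ i, k i * s * α i * (p i - 1) ∧ F a = F y := by
  choose G hG hFG using fun r i => UniversalAlgebra.exists_mem_Pol_of_mem_Pol_pi (hF r) i
  have hfactor : ∀ i, ∃ U : Finset (Fin n), U.card ≤ k i * s * α i * (p i - 1) ∧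
      ∀ r, G r i (fun j => a j i) = G r i (UniversalAlgebra.restrictZero U fun j => a j i) := by
    intro i
    -- Built on the given group structure, so that `0` and `+` stay the same.
    let _ : AddCommGroup (B i) :=
      { (inferInstance : AddGroup (B i)) with add_comm := (hB i).add_comm }
    obtain ⟨U, hU, hUeq⟩ := (hsn i).exists_restrictZero_eq (hB i).toIsExpandedGroup (hp i)
      ((hB i).prime_nsmul_eq_zero (hp i) (hcard i)) (hcard i)
      (F := fun x r => G r i x) (fun r => hG r i) (fun j => a j i)
    exact ⟨U, hU, congrFun hUeq⟩
  choose U hU hUeq using hfactor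
  refine ⟨fun j i => UniversalAlgebra.restrictZero (U i) (fun j => a j i) j, ?_, ?_⟩
  · calc _ ≤ (Finset.univ.biUnion U).card := by
          rw [UniversalAlgebra.weight, ← Set.ncard_coe_finset]
          refine Set.ncard_le_ncard (fun j hj => ?_) (Finset.finite_toSet _)
          by_contra hj'
          simp only [Finset.coe_biUnion, Set.mem_iUnion, not_exists] at hj'
          refine hj (funext fun i => ?_)
          have : j ∉ U i := by simpa using hj' i
          simp [UniversalAlgebra.restrictZero, this]
      _ ≤ ∑ i, (U i).card := Finset.card_biUnion_le
      _ ≤ _ := Finset.sum_le_sum fun i _ => hU i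
  · ext r i
    rw [hFG, hFG]
    exact hUeq i r
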